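/- Let $K$ be a field and let $q\in K$ satisfy $q\neq 0$ and $q^m\neq 1$ for all integers $m\ge 1$ (for example $K=\mathbb{R}$ or $\mathbb{C}$ with $0<|q|<1$, or $q$ an indeterminate over $\mathbb{Q}$). For $n,k\in\mathbb{N}$ with $k\le n$ put $$(x;q)_n=\prod_{j=0}^{n-1}(1-q^jx),\qquad \begin{bmatrix} n\\ k\end{bmatrix}_q=\frac{\prod_{j=0}^{k-1}(1-q^{n-j})}{\prod_{j=0}^{k-1}(1-q^{k-j})},$$ and, for $s\in K$, $$F(n,s,q)=\frac{\sum_{j=0}^n(-s)^j\begin{bmatrix} n\\ j\end{bmatrix}_q}{(q;q^2)_{\lfloor (n+1)/2\rfloor}}.$$ Then for all $n\ge 0$ and all $s\in K$ the Hankel determinants $$D_0(n,s,q)=\det\bigl(F(2i+2j,s,q)\bigr)_{i,j=0}^n,\qquad D_1(n,s,q)=\det\bigl(F(2i+2j+1,s,q)\bigr)_{i,j=0}^n$$ satisfy $$D_0(n,s,q)=D_0(n,0,q)\prod_{j=0}^n\left((s-q^{2j})(s-q^{2j+1})\left(s-\frac1{q^{2j}}\right)\left(s-\frac1{q^{2j+1}}\right)\right)^{n-j}$$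 and $$D_1(n,s,q)=D_1(n,0,q)\,(1-s)^{n+1}\prod_{j=0}^n\left((s-q^{2j+2})(s-q^{2j+1})\left(s-\frac1{q^{2j+2}}\right)\left(s-\frac1{q^{2j+1}}\right)\right)^{n-j}.$$ -/

import Mathlib

namespace RogersSzego

/-- The `q`-Pochhammer symbol `(x; q)_n = ∏_{j=0}^{n-1} (1 - q^j x)`. -/
def qPoch {K : Type*} [Field K] (x q : K) (n : ℕ) : K :=
  ∏ j ∈ Finset.range n, (1 - q ^ j * x)

/-- The `q`-binomial coefficient
`∏_{j=0}^{k-1} (1 - q^(n-j)) / ∏_{j=0}^{k-1} (1 - q^(k-j))`.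
For `k > n` the factor `j = n` of the numerator is `1 - q^0 = 0`, so the value is `0`. -/
def qBinom {K : Type*} [Field K] (q : K) (n k : ℕ) : K :=
  (∏ j ∈ Finset.range k, (1 - q ^ (n - j))) / ∏ j ∈ Finset.range k, (1 - q ^ (k - j))

/-- The Rogers-Szegö polynomial `r_n(s, q) = ∑_{j=0}^n [n choose j]_q s^j`. -/
def rogersSzego {K : Type*} [Field K] (n : ℕ) (s q : K) : K :=
  ∑ j ∈ Finset.range (n + 1), qBinom q n j * s ^ j

/-- The normalized Rogers-Szegö polynomial
`F(n, s, q) = (∑_{j=0}^n (-s)^j [n choose j]_q) / (q; q^2)_{⌊(n+1)/2⌋}`. -/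
def F {K : Type*} [Field K] (n : ℕ) (s q : K) : K :=
  rogersSzego n (-s) q / qPoch q (q ^ 2) ((n + 1) / 2)

/-- `D_0(n, s, q) = det (F(2i+2j, s, q))_{i,j=0}^n`. -/
def D₀ {K : Type*} [Field K] (n : ℕ) (s q : K) : K :=
  Matrix.det (Matrix.of fun i j : Fin (n + 1) => F (2 * (i : ℕ) + 2 * (j : ℕ)) s q)

/-- `D_1(n, s, q) = det (F(2i+2j+1, s, q))_{i,j=0}^n`. -/
def D₁ {K : Type*} [Field K] (n : ℕ) (s q : K) : K :=
  Matrix.det (Matrix.of fun i j : Fin (n + 1) => F (2 * (i : ℕ) + 2 * (j : ℕ) + 1) s q)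

end RogersSzego

namespace RogersSzego

open Polynomial

variable {K : Type*} [Field K]

/-! ### The three-term recurrence of the Rogers-Szegö polynomials -/

/-! Let `L` be the linear functional on polynomials with moments `F (2 * n)` (`t = 1`) or `F (2 * n
+ 1)` (`t = q`). Iterating the three-term recurrence gives `IsJacobiMoment`, a `q ^ 2`-difference
equation for `L`. Evaluated on the products `shiftedFactorial`, it collapses to a first-order
recursion, and `momentFunctional_shiftedFactorial_mul` extends this to products of the families with
parameters `t` and `t * q`. In these monic bases the Hankel matrix becomes diagonal times `m 0`
times an `s`-free matrix times diagonal. The diagonals yield the asserted product; the `s`-free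
determinant is read off at `s = 0`. -/

lemma qBinom_zero_right (q : K) (n : ℕ) : qBinom q n 0 = 1 := by
  simp [qBinom]

lemma qBinom_eq_zero (q : K) {n k : ℕ} (h : n < k) : qBinom q n k = 0 := by
  rw [qBinom, Finset.prod_eq_zero (Finset.mem_range.2 h) (by simp), zero_div]

lemma qBinom_succ_succ_mul {q : K} (hq : ∀ m : ℕ, 0 < m → q ^ m ≠ 1) (n k : ℕ) :
    (1 - q ^ (k + 1)) * qBinom q (n + 1) (k + 1) = (1 - q ^ (n + 1)) * qBinom q n k := by
  have h : (1 - q ^ (k + 1)) ≠ 0 := sub_ne_zero.2 (hq _ k.succ_pos).symm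
  simp only [qBinom, Finset.prod_range_succ', Nat.add_sub_add_right, Nat.sub_zero]
  rw [mul_div_mul_comm]
  field_simp

lemma qBinom_succ_right_mul {q : K} (hq : ∀ m : ℕ, 0 < m → q ^ m ≠ 1) (n k : ℕ) :
    (1 - q ^ (k + 1)) * qBinom q n (k + 1) = (1 - q ^ (n - k)) * qBinom q n k := by
  have h : (1 - q ^ (k + 1)) ≠ 0 := sub_ne_zero.2 (hq _ k.succ_pos).symm
  have hD : ∏ j ∈ Finset.range (k + 1), (1 - q ^ (k + 1 - j))
      = (∏ j ∈ Finset.range k, (1 - q ^ (k - j))) * (1 - q ^ (k + 1)) := by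
    simp [Finset.prod_range_succ']
  rw [qBinom, qBinom, hD, Finset.prod_range_succ, mul_div_mul_comm]
  field_simp

lemma qBinom_pascal {q : K} (hq : ∀ m : ℕ, 0 < m → q ^ m ≠ 1) (n k : ℕ) :
    qBinom q (n + 1) (k + 1) = qBinom q n k + q ^ (k + 1) * qBinom q n (k + 1) := by
  have h : (1 - q ^ (k + 1)) ≠ 0 := sub_ne_zero.2 (hq _ k.succ_pos).symm
  -- The exponent `n - k` is truncated, so `q ^ (k + 1) * q ^ (n - k) = q ^ (n + 1)` needs `k ≤ n`.
  rcases lt_or_ge n k with hk | hk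
  · rw [qBinom_eq_zero q hk, qBinom_eq_zero q (by omega : n < k + 1),
      qBinom_eq_zero q (by omega : n + 1 < k + 1)]
    ring
  · apply mul_left_cancel₀ h
    obtain ⟨d, rfl⟩ := Nat.exists_eq_add_of_le hk
    have h2 := qBinom_succ_right_mul hq (k + d) k
    rw [Nat.add_sub_cancel_left] at h2
    linear_combination qBinom_succ_succ_mul hq (k + d) k - q ^ (k + 1) * h2

lemma rogersSzego_add_two {q : K} (hq : ∀ m : ℕ, 0 < m → q ^ m ≠ 1) (n : ℕ) (x : K) :
    rogersSzego (n + 2) x q =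
      (1 + x) * rogersSzego (n + 1) x q - x * (1 - q ^ (n + 1)) * rogersSzego n x q := by
  have h1 : rogersSzego (n + 1) x q =
      ∑ k ∈ Finset.range (n + 2), qBinom q (n + 1) (k + 1) * x ^ (k + 1) + 1 := by
    rw [rogersSzego, Finset.sum_range_succ', Finset.sum_range_succ _ (n + 1),
      qBinom_eq_zero q (by omega : n + 1 < n + 1 + 1), qBinom_zero_right]
    ring
  have h0 : rogersSzego n x q = ∑ k ∈ Finset.range (n + 2), qBinom q n k * x ^ k := by
    rw [rogersSzego, Finset.sum_range_succ _ (n + 1), qBinom_eq_zero q (by omega : n < n + 1)]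
    ring
  have h1' : rogersSzego (n + 1) x q =
      ∑ k ∈ Finset.range (n + 2), qBinom q (n + 1) k * x ^ k := rfl
  rw [add_mul, one_mul, h0]
  nth_rewrite 1 [h1]
  rw [h1', rogersSzego, Finset.sum_range_succ', qBinom_zero_right, Finset.mul_sum, Finset.mul_sum,
    pow_zero, mul_one, add_right_comm, add_sub_right_comm, ← Finset.sum_add_distrib,
    ← Finset.sum_sub_distrib]
  congr 1
  refine Finset.sum_congr rfl fun k _ => ?_
  rw [qBinom_pascal hq (n + 1) k]
  linear_combination (-x ^ (k + 1)) * qBinom_succ_succ_mul hq n k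

lemma rogersSzego_add_four {q : K} (hq : ∀ m : ℕ, 0 < m → q ^ m ≠ 1) (n : ℕ) (s : K) :
    rogersSzego (n + 4) (-s) q =
      (1 + s ^ 2 - s * (1 + q) * q ^ (n + 2)) * rogersSzego (n + 2) (-s) q
        - s ^ 2 * (1 - q ^ (n + 1)) * (1 - q ^ (n + 2)) * rogersSzego n (-s) q := by
  have e2 := rogersSzego_add_two hq n (-s)
  have e3 := rogersSzego_add_two hq (n + 1) (-s)
  have e4 := rogersSzego_add_two hq (n + 2) (-s)
  -- These multipliers eliminate the terms of index `n + 3` and `n + 1`.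
  linear_combination e4 + (1 - s) * e3 - s * (1 - q ^ (n + 2)) * e2

lemma rogersSzego_zero (x q : K) : rogersSzego 0 x q = 1 := by
  simp [rogersSzego, qBinom_zero_right]

lemma rogersSzego_one {q : K} (hq : ∀ m : ℕ, 0 < m → q ^ m ≠ 1) (x : K) :
    rogersSzego 1 x q = 1 + x := by
  have h : 1 - q ≠ 0 := sub_ne_zero.2 (by simpa using (hq 1 one_pos).symm)
  simp [rogersSzego, Finset.sum_range_succ, qBinom, div_self h]

lemma rogersSzego_zero_right (n : ℕ) (q : K) : rogersSzego n 0 q = 1 := by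
  simp [rogersSzego, Finset.sum_range_succ', qBinom_zero_right]

/-! ### Moment functionals and Hankel determinants -/

/-- The linear functional on polynomials with moments `m`. -/
noncomputable def momentFunctional (m : ℕ → K) : K[X] →ₗ[K] K :=
  Polynomial.lsum fun n => m n • LinearMap.id

lemma momentFunctional_monomial (m : ℕ → K) (n : ℕ) (a : K) :
    momentFunctional m (monomial n a) = m n * a := by
  simp [momentFunctional]

lemma momentFunctional_one (m : ℕ → K) : momentFunctional m 1 = m 0 := by
  simpa using momentFunctional_monomial m 0 1

lemma momentFunctional_mul_eq_sum (m : ℕ → K) {N : ℕ} {f g : K[X]}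
    (hf : f.natDegree < N) (hg : g.natDegree < N) :
    momentFunctional m (f * g) =
      ∑ a : Fin N, ∑ b : Fin N, f.coeff a * m (a + b) * g.coeff b := by
  conv_lhs => rw [f.as_sum_range' N hf, g.as_sum_range' N hg]
  rw [Finset.sum_mul_sum, map_sum, Finset.sum_range]
  refine Finset.sum_congr rfl fun a _ => ?_
  rw [map_sum, Finset.sum_range]
  refine Finset.sum_congr rfl fun b _ => ?_
  rw [monomial_mul_monomial, momentFunctional_monomial]
  ring

/-- A Hankel determinant may be computed from any two families of monic polynomials. -/
lemma det_hankel_eq_det_momentFunctional (m : ℕ → K) (N : ℕ) (f g : ℕ → K[X])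
    (hf : ∀ i, (f i).Monic) (hf' : ∀ i, (f i).natDegree = i)
    (hg : ∀ i, (g i).Monic) (hg' : ∀ i, (g i).natDegree = i) :
    Matrix.det (Matrix.of fun i j : Fin N => m (i + j)) =
      Matrix.det (Matrix.of fun i j : Fin N => momentFunctional m (f i * g j)) := by
  have key : (Matrix.of fun i j : Fin N => momentFunctional m (f i * g j)) =
      (Matrix.of fun a i : Fin N => (f i).coeff a).transpose *
        (Matrix.of fun i j : Fin N => m (i + j)) *
        (Matrix.of fun b j : Fin N => (g j).coeff b) := by
    ext i j
    simp only [Matrix.of_apply, Matrix.mul_apply, Matrix.transpose_apply, Finset.sum_mul]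
    rw [momentFunctional_mul_eq_sum m (N := N) (by rw [hf']; exact i.2) (by rw [hg']; exact j.2),
      Finset.sum_comm]
  rw [key, Matrix.det_mul, Matrix.det_mul, Matrix.det_transpose,
    Matrix.det_matrixOfPolynomials (fun i : Fin N => f i) (fun i => hf' i) (fun i => hf i),
    Matrix.det_matrixOfPolynomials (fun i : Fin N => g i) (fun i => hg' i) (fun i => hg i)]
  simp

/-- The monic polynomial `∏_{l<k} (X - s / (t p^l))`. -/
noncomputable def shiftedFactorial (s t p : K) (k : ℕ) : K[X] :=
  ∏ l ∈ Finset.range k, (X - C (s / (t * p ^ l)))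

lemma shiftedFactorial_succ (s t p : K) (k : ℕ) :
    shiftedFactorial s t p (k + 1) = shiftedFactorial s t p k * (X - C (s / (t * p ^ k))) :=
  Finset.prod_range_succ _ _

lemma shiftedFactorial_monic (s t p : K) (k : ℕ) : (shiftedFactorial s t p k).Monic :=
  monic_prod_of_monic _ _ fun _ _ => monic_X_sub_C _

lemma natDegree_shiftedFactorial (s t p : K) (k : ℕ) :
    (shiftedFactorial s t p k).natDegree = k := by
  rw [shiftedFactorial, natDegree_prod_of_monic _ _ fun _ _ => monic_X_sub_C _]
  simp

/-- Dilating by `p` moves each root `s / (t * p ^ l)` to the next one; only the first root `s / t`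
is lost. -/
lemma shiftedFactorial_comp {s t p : K} (hp : p ≠ 0) (k : ℕ) :
    (X - C (s / t)) * (shiftedFactorial s t p k).comp (C p * X) =
      C (p ^ k) * shiftedFactorial s t p (k + 1) := by
  have h : (shiftedFactorial s t p k).comp (C p * X) =
      C (p ^ k) * ∏ l ∈ Finset.range k, (X - C (s / (t * p ^ (l + 1)))) := by
    rw [shiftedFactorial, Polynomial.prod_comp]
    conv_rhs => rw [← Finset.card_range k, map_pow, ← Finset.prod_const, Finset.card_range,
      ← Finset.prod_mul_distrib]
    refine Finset.prod_congr rfl fun l _ => ?_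
    rw [sub_comp, X_comp, C_comp, mul_sub, ← C_mul]
    congr 2
    rw [pow_succ, ← mul_assoc, ← mul_div_assoc, mul_comm p s, mul_div_mul_right _ _ hp]
  rw [h, shiftedFactorial, Finset.prod_range_succ']
  simp only [pow_zero, mul_one]
  ring

/-- The values `∏_{l<k} (s - t p^l) (s - 1 / (t p^l))`. -/
def reciprocalProd (s t p : K) (k : ℕ) : K :=
  ∏ l ∈ Finset.range k, ((s - t * p ^ l) * (s - 1 / (t * p ^ l)))

lemma reciprocalProd_succ (s t p : K) (k : ℕ) :
    reciprocalProd s t p (k + 1) =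
      reciprocalProd s t p k * ((s - t * p ^ k) * (s - 1 / (t * p ^ k))) :=
  Finset.prod_range_succ _ _

lemma prod_reciprocalProd (s t p : K) (n : ℕ) :
    ∏ i : Fin (n + 1), reciprocalProd s t p i =
      ∏ l ∈ Finset.range (n + 1), ((s - t * p ^ l) * (s - 1 / (t * p ^ l))) ^ (n - l) := by
  rw [← Finset.prod_range fun i => reciprocalProd s t p i]
  induction n with
  | zero => simp [reciprocalProd]
  | succ n ih =>
    rw [Finset.prod_range_succ, ih, reciprocalProd, ← Finset.prod_mul_distrib,
      Finset.prod_range_succ _ (n + 1), Nat.sub_self, pow_zero, mul_one]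
    -- The factor with index `l` occurs in `reciprocalProd s t p i` exactly when `l < i`, so each
    -- step adds one to its exponent.
    refine Finset.prod_congr rfl fun l hl => ?_
    rw [← pow_succ, Nat.succ_sub (Nat.lt_succ_iff.1 (Finset.mem_range.1 hl))]

/-- A moment sequence whose functional satisfies a first order `q ^ 2`-difference equation. -/
structure IsJacobiMoment (q s t : K) (m : ℕ → K) : Prop where
  one : (1 - t ^ 2 * q) * m 1 = (1 + s ^ 2 - s * t * (1 + q)) * m 0
  add_two : ∀ n, (1 - t ^ 2 * q * (q ^ 2) ^ (n + 1)) * m (n + 2) =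
    (1 + s ^ 2 - s * t * (1 + q) * (q ^ 2) ^ (n + 1)) * m (n + 1)
      - s ^ 2 * (1 - (q ^ 2) ^ (n + 1)) * m n

/-! ### Pearson equation, mixed moments and the Hankel determinant -/

namespace IsJacobiMoment

variable {q s t : K} {m : ℕ → K}

/-- On monomials this is the moment recurrence: dilation produces the powers of `q ^ 2`, and `divX`
lowers the index. Constants give `one`, since there the `divX` term vanishes. -/
lemma momentFunctional_pearson (h : IsJacobiMoment q s t m) (f : K[X]) :
    momentFunctional m (X * f - C (t ^ 2 * q) * (X * f.comp (C (q ^ 2) * X)) - C (1 + s ^ 2) * f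
      + C (s * t * (1 + q)) * f.comp (C (q ^ 2) * X)
      + C (s ^ 2) * divX (f - f.comp (C (q ^ 2) * X))) = 0 := by
  induction f using Polynomial.induction_on' with
  | add f g hf hg =>
    rw [← add_zero (0 : K)]
    nth_rewrite 1 [← hf]
    rw [← hg, ← map_add]
    congr 1
    rw [add_comp, add_sub_add_comm, divX_add]
    ring
  | monomial n a =>
    have hc : (monomial n a).comp (C (q ^ 2) * X) = monomial n (a * (q ^ 2) ^ n) := by
      rw [monomial_comp, mul_pow, ← C_pow, ← mul_assoc, ← C_mul, C_mul_X_pow_eq_monomial]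
    rw [hc, ← map_sub]
    cases n with
    | zero =>
      have hd : divX (monomial 0 (a - a * (q ^ 2) ^ 0)) = 0 := by simp
      rw [hd]
      simp only [X_mul_monomial, C_mul_monomial, mul_zero, add_zero]
      simp only [map_add (momentFunctional m), map_sub (momentFunctional m),
        momentFunctional_monomial]
      linear_combination a * h.one
    | succ n =>
      have hd : divX (monomial (n + 1) (a - a * (q ^ 2) ^ (n + 1))) =
          monomial n (a - a * (q ^ 2) ^ (n + 1)) := by
        ext k
        simp [coeff_divX, coeff_monomial]
      rw [hd]
      simp only [X_mul_monomial, C_mul_monomial]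
      simp only [map_add (momentFunctional m), map_sub (momentFunctional m),
        momentFunctional_monomial]
      linear_combination a * h.add_two n

lemma momentFunctional_shiftedFactorial_succ (h : IsJacobiMoment q s t m) (hq : q ≠ 0)
    (ht : t ≠ 0) (k : ℕ) :
    (1 - t ^ 2 * q * (q ^ 2) ^ k) *
        momentFunctional m (shiftedFactorial s t (q ^ 2) (k + 1)) =
      (s - t * (q ^ 2) ^ k) * (s - 1 / (t * (q ^ 2) ^ k)) *
        momentFunctional m (shiftedFactorial s t (q ^ 2) k) := by
  have hp : q ^ 2 ≠ 0 := pow_ne_zero 2 hq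
  have hT : t * (q ^ 2) ^ k ≠ 0 := mul_ne_zero ht (pow_ne_zero k hp)
  have key := h.momentFunctional_pearson (shiftedFactorial s t (q ^ 2) k)
  have hE := shiftedFactorial_comp (s := s) (t := t) hp k
  have hS := shiftedFactorial_succ s t (q ^ 2) k
  set f := shiftedFactorial s t (q ^ 2) k
  set f' := shiftedFactorial s t (q ^ 2) (k + 1)
  set e := f.comp (C (q ^ 2) * X)
  set T := t * (q ^ 2) ^ k with hTdef
  have hd : X * divX (f - e) = f - e := by
    have h0 : (f - e).coeff 0 = 0 := by simp [e, coeff_zero_eq_eval_zero]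
    have := X_mul_divX_add (f - e)
    rwa [h0, C_0, add_zero] at this
  have hsT : C (s / T) * C T = (C s : K[X]) := by rw [← C_mul, div_mul_cancel₀ _ hT]
  have hst : C (s / t) * C t = (C s : K[X]) := by rw [← C_mul, div_mul_cancel₀ _ ht]
  have hTC : (C T : K[X]) = C t * C ((q ^ 2) ^ k) := by rw [← C_mul]
  -- The dilate `e` and `f` share all but their end roots.
  have hE' : (C t * X - C s) * e = C T * X * f - C s * f := by
    rw [hTC]
    rw [hTC] at hsT
    linear_combination C t * hE + C t * C ((q ^ 2) ^ k) * hS + e * hst - f * hsT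
  have hpoly : X * f - C (t ^ 2 * q) * (X * e) - C (1 + s ^ 2) * f + C (s * t * (1 + q)) * e
      + C (s ^ 2) * divX (f - e) =
      C (1 - t * q * T) * f' +
        C ((1 - t * q * T) * (s / T) - (1 + s ^ 2 - t * q * s - s * T)) * f := by
    -- After multiplication by `X`, the coefficient of `e` is `-(t * q * X - s) * (t * X - s)`, so
    -- `hE'` eliminates `e`.
    apply mul_left_cancel₀ (X_ne_zero (R := K))
    rw [hS]
    simp only [C_mul, C_sub, C_add, C_1, C_pow] at *
    linear_combination (C s) ^ 2 * hd - (C t * C q * X - C s) * hE'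
  rw [hpoly, map_add, ← smul_eq_C_mul, ← smul_eq_C_mul, map_smul, map_smul, smul_eq_mul,
    smul_eq_mul] at key
  have e1 : 1 - t ^ 2 * q * (q ^ 2) ^ k = 1 - t * q * T := by rw [hTdef]; ring
  rw [e1]
  have e2 : (s - T) * (s - 1 / T) =
      -((1 - t * q * T) * (s / T) - (1 + s ^ 2 - t * q * s - s * T)) := by
    field_simp
    ring
  rw [e2]
  linear_combination key

/-- The mixed moments of the two families of shifted factorials have product form. -/
lemma momentFunctional_shiftedFactorial_mul (h : IsJacobiMoment q s t m) (hq : q ≠ 0)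
    (ht : t ≠ 0) (hd : ∀ n : ℕ, 1 - t ^ 2 * q * (q ^ 2) ^ n ≠ 0) (i j : ℕ) :
    momentFunctional m
        (shiftedFactorial s t (q ^ 2) i * shiftedFactorial s (t * q) (q ^ 2) j) =
      reciprocalProd s t (q ^ 2) i *
        (m 0 / ∏ l ∈ Finset.range (i + j), (1 - t ^ 2 * q * (q ^ 2) ^ l)) *
        reciprocalProd s (t * q) (q ^ 2) j := by
  have hp : q ^ 2 ≠ 0 := pow_ne_zero 2 hq
  induction j generalizing i with
  | zero =>
    induction i with
    | zero => simp [shiftedFactorial, reciprocalProd, momentFunctional_one]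
    | succ i ih =>
      apply mul_left_cancel₀ (hd i)
      have e0 : shiftedFactorial s (t * q) (q ^ 2) 0 = 1 := by simp [shiftedFactorial]
      rw [e0, mul_one] at ih ⊢
      rw [h.momentFunctional_shiftedFactorial_succ hq ht, ih, reciprocalProd_succ, add_zero,
        add_zero, Finset.prod_range_succ]
      have := hd i
      have := Finset.prod_ne_zero_iff.2 fun l (_ : l ∈ Finset.range i) => hd l
      field_simp
  | succ j ih =>
    have hA : t * (q ^ 2) ^ i ≠ 0 := mul_ne_zero ht (pow_ne_zero i hp)
    have hB : t * q * (q ^ 2) ^ j ≠ 0 := mul_ne_zero (mul_ne_zero ht hq) (pow_ne_zero j hp)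
    -- The shift from `t` to `t * q` in the second family makes the denominator `1 - A * B`, which
    -- is symmetric in the two parameters.
    have hAB : 1 - t ^ 2 * q * (q ^ 2) ^ (i + j) =
        1 - (t * (q ^ 2) ^ i) * (t * q * (q ^ 2) ^ j) := by ring
    have hne := hd (i + j)
    have hP := Finset.prod_ne_zero_iff.2 fun l (_ : l ∈ Finset.range (i + j)) => hd l
    have h1 := ih i
    have h2 := ih (i + 1)
    rw [shiftedFactorial_succ, reciprocalProd_succ, add_right_comm, Finset.prod_range_succ] at h2
    rw [shiftedFactorial_succ, reciprocalProd_succ, ← add_assoc, Finset.prod_range_succ]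
    rw [hAB] at h2 hne ⊢
    generalize t * (q ^ 2) ^ i = A at *
    generalize t * q * (q ^ 2) ^ j = B at *
    have hpoly : shiftedFactorial s t (q ^ 2) i *
          (shiftedFactorial s (t * q) (q ^ 2) j * (X - C (s / B))) =
        shiftedFactorial s t (q ^ 2) i * (X - C (s / A)) *
          shiftedFactorial s (t * q) (q ^ 2) j +
        C (s / A - s / B) *
          (shiftedFactorial s t (q ^ 2) i * shiftedFactorial s (t * q) (q ^ 2) j) := by
      rw [C_sub]
      ring
    rw [hpoly, map_add, ← smul_eq_C_mul, map_smul, smul_eq_mul, h1, h2]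
    -- What remains is `(s - A) * (s - 1 / A) + (s / A - s / B) * (1 - A * B) = (s - B) * (s - 1 /
    -- B)`.
    field_simp
    ring

lemma det_hankel (h : IsJacobiMoment q s t m) (hq : q ≠ 0)
    (ht : t ≠ 0) (hd : ∀ n : ℕ, 1 - t ^ 2 * q * (q ^ 2) ^ n ≠ 0) (n : ℕ) :
    Matrix.det (Matrix.of fun i j : Fin (n + 1) => m (i + j)) =
      m 0 ^ (n + 1) * Matrix.det (Matrix.of fun i j : Fin (n + 1) =>
        (∏ l ∈ Finset.range ((i : ℕ) + j), (1 - t ^ 2 * q * (q ^ 2) ^ l))⁻¹) *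
      ∏ l ∈ Finset.range (n + 1),
        ((s - t * (q ^ 2) ^ l) * (s - t * q * (q ^ 2) ^ l) *
          (s - 1 / (t * (q ^ 2) ^ l)) * (s - 1 / (t * q * (q ^ 2) ^ l))) ^ (n - l) := by
  rw [det_hankel_eq_det_momentFunctional m (n + 1) (shiftedFactorial s t (q ^ 2))
    (shiftedFactorial s (t * q) (q ^ 2)) (shiftedFactorial_monic _ _ _)
    (natDegree_shiftedFactorial _ _ _) (shiftedFactorial_monic _ _ _)
    (natDegree_shiftedFactorial _ _ _)]
  have hM : (Matrix.of fun i j : Fin (n + 1) => momentFunctional m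
        (shiftedFactorial s t (q ^ 2) i * shiftedFactorial s (t * q) (q ^ 2) j)) =
      Matrix.diagonal (fun i : Fin (n + 1) => reciprocalProd s t (q ^ 2) i) *
        (m 0 • Matrix.of fun i j : Fin (n + 1) =>
          (∏ l ∈ Finset.range ((i : ℕ) + j), (1 - t ^ 2 * q * (q ^ 2) ^ l))⁻¹) *
        Matrix.diagonal (fun j : Fin (n + 1) => reciprocalProd s (t * q) (q ^ 2) j) := by
    ext i j
    rw [Matrix.mul_diagonal, Matrix.diagonal_mul, Matrix.of_apply,
      h.momentFunctional_shiftedFactorial_mul hq ht hd, div_eq_mul_inv]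
    rfl
  rw [hM, Matrix.det_mul, Matrix.det_mul, Matrix.det_diagonal, Matrix.det_diagonal,
    Matrix.det_smul, Fintype.card_fin, prod_reciprocalProd, prod_reciprocalProd, mul_comm,
    mul_left_comm, ← mul_assoc, mul_comm _ (_ * _), ← Finset.prod_mul_distrib]
  congr 1
  refine Finset.prod_congr rfl fun l _ => ?_
  rw [← mul_pow]
  congr 1
  ring

end IsJacobiMoment

/-! ### The even and odd Rogers-Szegö moments -/

lemma one_sub_pow_ne_zero {q : K} (hq : ∀ m : ℕ, 0 < m → q ^ m ≠ 1) {m : ℕ} (hm : 0 < m) :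
    1 - q ^ m ≠ 0 :=
  sub_ne_zero.2 (hq m hm).symm

lemma qPoch_succ (x q : K) (n : ℕ) : qPoch x q (n + 1) = qPoch x q n * (1 - q ^ n * x) :=
  Finset.prod_range_succ _ _

lemma qPoch_sq_ne_zero {q : K} (hq : ∀ m : ℕ, 0 < m → q ^ m ≠ 1) (n : ℕ) :
    qPoch q (q ^ 2) n ≠ 0 :=
  Finset.prod_ne_zero_iff.2 fun j _ => by
    rw [← pow_mul, ← pow_succ]
    exact one_sub_pow_ne_zero hq (Nat.succ_pos _)

lemma F_even (n : ℕ) (s q : K) :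
    F (2 * n) s q = rogersSzego (2 * n) (-s) q / qPoch q (q ^ 2) n := by
  rw [F, show (2 * n + 1) / 2 = n by omega]

lemma F_odd (n : ℕ) (s q : K) :
    F (2 * n + 1) s q = rogersSzego (2 * n + 1) (-s) q / qPoch q (q ^ 2) (n + 1) := by
  rw [F, show (2 * n + 1 + 1) / 2 = n + 1 by omega]

lemma isJacobiMoment_even {q : K} (hq : ∀ m : ℕ, 0 < m → q ^ m ≠ 1) (s : K) :
    IsJacobiMoment q s 1 (fun n => F (2 * n) s q) where
  one := by
    have h2 := rogersSzego_add_two hq 0 (-s)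
    rw [zero_add, zero_add, rogersSzego_one hq, rogersSzego_zero] at h2
    have h := one_sub_pow_ne_zero hq one_pos
    rw [pow_one] at h
    simp only [F_even]
    simp only [mul_one, mul_zero, h2, rogersSzego_zero, qPoch, Finset.prod_range_one,
      Finset.prod_range_zero, pow_zero, one_mul, one_pow, div_one]
    rw [mul_div_cancel₀ _ h]
    ring
  add_two n := by
    have h := rogersSzego_add_four hq (2 * n) s
    have hP := qPoch_sq_ne_zero hq n
    have h1 := qPoch_sq_ne_zero hq (n + 1)
    have h2 := qPoch_sq_ne_zero hq (n + 1 + 1)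
    simp only [F_even]
    simp only [show 2 * (n + 2) = 2 * n + 4 by ring, show 2 * (n + 1) = 2 * n + 2 by ring,
      h, show n + 2 = n + 1 + 1 by ring]
    rw [qPoch_succ] at h2 ⊢
    rw [qPoch_succ] at h1 h2 ⊢
    obtain ⟨-, ha⟩ := mul_ne_zero_iff.1 h1
    obtain ⟨-, hb⟩ := mul_ne_zero_iff.1 h2
    rw [show 1 - 1 ^ 2 * q * (q ^ 2) ^ (n + 1) = 1 - (q ^ 2) ^ (n + 1) * q by ring,
      show q ^ (2 * n + 1) = (q ^ 2) ^ n * q by ring,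
      show q ^ (2 * n + 2) = (q ^ 2) ^ (n + 1) by ring, mul_one s]
    generalize 1 - (q ^ 2) ^ n * q = a at *
    generalize 1 - (q ^ 2) ^ (n + 1) * q = b at *
    field_simp

lemma isJacobiMoment_odd {q : K} (hq : ∀ m : ℕ, 0 < m → q ^ m ≠ 1) (s : K) :
    IsJacobiMoment q s q (fun n => F (2 * n + 1) s q) where
  one := by
    have h2 := rogersSzego_add_two hq 0 (-s)
    have h3 := rogersSzego_add_two hq 1 (-s)
    simp only [zero_add, Nat.reduceAdd, rogersSzego_one hq, rogersSzego_zero] at h2 h3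
    rw [h2] at h3
    have ha := qPoch_sq_ne_zero hq 1
    have hb := qPoch_sq_ne_zero hq 2
    simp only [F_odd]
    simp only [mul_one, mul_zero, zero_add, Nat.reduceAdd, h3, rogersSzego_one hq]
    rw [qPoch_succ _ _ 1] at hb ⊢
    obtain ⟨-, hb⟩ := mul_ne_zero_iff.1 hb
    rw [pow_one, show q ^ 2 * q = q ^ 3 by ring] at hb ⊢
    field_simp
    ring
  add_two n := by
    have h := rogersSzego_add_four hq (2 * n + 1) s
    have hP := qPoch_sq_ne_zero hq (n + 1)
    have h1 := qPoch_sq_ne_zero hq (n + 1 + 1)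
    have h2 := qPoch_sq_ne_zero hq (n + 1 + 1 + 1)
    simp only [F_odd]
    simp only [show 2 * (n + 2) + 1 = 2 * n + 1 + 4 by ring,
      show 2 * (n + 1) + 1 = 2 * n + 1 + 2 by ring, h, show n + 2 = n + 1 + 1 by ring]
    rw [qPoch_succ _ _ (n + 1 + 1)] at h2 ⊢
    rw [qPoch_succ _ _ (n + 1)] at h1 h2 ⊢
    obtain ⟨-, ha⟩ := mul_ne_zero_iff.1 h1
    obtain ⟨-, hb⟩ := mul_ne_zero_iff.1 h2
    rw [show 1 - q ^ 2 * q * (q ^ 2) ^ (n + 1) = 1 - (q ^ 2) ^ (n + 1 + 1) * q by ring,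
      show q ^ (2 * n + 1 + 1) = (q ^ 2) ^ (n + 1) by ring,
      show q ^ (2 * n + 1 + 2) = (q ^ 2) ^ (n + 1) * q by ring,
      show s * q * (1 + q) * (q ^ 2) ^ (n + 1) = s * (1 + q) * ((q ^ 2) ^ (n + 1) * q) by ring]
    generalize 1 - (q ^ 2) ^ (n + 1 + 1) * q = b at *
    generalize (q ^ 2) ^ (n + 1) = Q at *
    rw [mul_comm Q q] at ha ⊢
    field_simp

lemma D₀_zero (n : ℕ) (q : K) :
    D₀ n 0 q = Matrix.det (Matrix.of fun i j : Fin (n + 1) =>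
      (∏ l ∈ Finset.range ((i : ℕ) + j), (1 - 1 ^ 2 * q * (q ^ 2) ^ l))⁻¹) := by
  rw [D₀]
  congr 2
  ext i j
  rw [← mul_add, F_even, neg_zero, rogersSzego_zero_right, one_div, qPoch]
  simp only [one_pow, one_mul, mul_comm q]

/-- The odd denominators have one extra factor `1 - q`, pulled out of every entry; it later merges
with `m 0 = (1 - s) / (1 - q)`. -/
lemma D₁_zero (n : ℕ) (q : K) :
    D₁ n 0 q = ((1 - q)⁻¹) ^ (n + 1) * Matrix.det (Matrix.of fun i j : Fin (n + 1) =>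
      (∏ l ∈ Finset.range ((i : ℕ) + j), (1 - q ^ 2 * q * (q ^ 2) ^ l))⁻¹) := by
  have e : ((1 - q)⁻¹) ^ (n + 1) = ((1 - q)⁻¹) ^ Fintype.card (Fin (n + 1)) := by simp
  rw [D₁, e, ← Matrix.det_smul]
  congr 1
  ext i j
  rw [Matrix.of_apply, ← mul_add, F_odd, neg_zero, rogersSzego_zero_right, one_div, qPoch,
    Finset.prod_range_succ', mul_inv_rev, pow_zero, one_mul]
  simp only [Matrix.smul_apply, Matrix.of_apply, smul_eq_mul, pow_succ, pow_zero, one_mul]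
  congr 2
  refine Finset.prod_congr rfl fun l _ => ?_
  ring

end RogersSzego

theorem theorem3p2 {K : Type*} [Field K] (q : K) (hq0 : q ≠ 0)
    (hq : ∀ m : ℕ, 0 < m → q ^ m ≠ 1) (n : ℕ) (s : K) :
    RogersSzego.D₀ n s q = RogersSzego.D₀ n 0 q *
        ∏ j ∈ Finset.range (n + 1),
          ((s - q ^ (2 * j)) * (s - q ^ (2 * j + 1)) *
            (s - 1 / q ^ (2 * j)) * (s - 1 / q ^ (2 * j + 1))) ^ (n - j) ∧
    RogersSzego.D₁ n s q = RogersSzego.D₁ n 0 q * (1 - s) ^ (n + 1) *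
        ∏ j ∈ Finset.range (n + 1),
          ((s - q ^ (2 * j + 2)) * (s - q ^ (2 * j + 1)) *
            (s - 1 / q ^ (2 * j + 2)) * (s - 1 / q ^ (2 * j + 1))) ^ (n - j) := by
  constructor
  · have hd : ∀ n : ℕ, 1 - 1 ^ 2 * q * (q ^ 2) ^ n ≠ 0 := fun n => by
      rw [one_pow, one_mul, ← pow_mul, ← pow_succ']
      exact RogersSzego.one_sub_pow_ne_zero hq (Nat.succ_pos _)
    have h := (RogersSzego.isJacobiMoment_even hq s).det_hankel hq0 one_ne_zero hd n
    have h0 : RogersSzego.F (2 * 0) s q = 1 := by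
      rw [RogersSzego.F_even, mul_zero, RogersSzego.rogersSzego_zero]
      simp [RogersSzego.qPoch]
    rw [h0, one_pow, one_mul, ← RogersSzego.D₀_zero] at h
    simp only [mul_add] at h
    rw [RogersSzego.D₀, h]
    congr 1
    refine Finset.prod_congr rfl fun j _ => ?_
    rw [← pow_mul, one_mul, one_mul, ← pow_succ']
  · have hd : ∀ n : ℕ, 1 - q ^ 2 * q * (q ^ 2) ^ n ≠ 0 := fun n => by
      rw [← pow_succ, ← pow_mul, ← pow_add]
      exact RogersSzego.one_sub_pow_ne_zero hq (by omega)
    have h := (RogersSzego.isJacobiMoment_odd hq s).det_hankel hq0 hq0 hd n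
    have h0 : RogersSzego.F (2 * 0 + 1) s q = (1 - q)⁻¹ * (1 - s) := by
      rw [RogersSzego.F_odd, mul_zero, zero_add, RogersSzego.rogersSzego_one hq]
      simp [RogersSzego.qPoch, div_eq_inv_mul, sub_eq_add_neg]
    rw [h0, mul_pow, mul_right_comm _ ((1 - s) ^ (n + 1)), ← RogersSzego.D₁_zero] at h
    simp only [mul_add] at h
    rw [RogersSzego.D₁, h]
    congr 1
    refine Finset.prod_congr rfl fun j _ => ?_
    rw [show q * q * (q ^ 2) ^ j = q ^ (2 * j + 2) by ring,
      show q * (q ^ 2) ^ j = q ^ (2 * j + 1) by ring]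
    congr 1
    ring
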